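/- For a finite set $A$ let $\mathcal L(A)$ be the set of strict linear orders on $A$; a domain is a subset of $\mathcal L(A)$. A non-empty domain is a Condorcet domain if the strict majority relation of every profile over it with an odd number of voters is transitive. A domain is peak-pit if in every triple of distinct alternatives some alternative is never ranked first among the three, or some alternative is never ranked last among the three. A domain has maximal width if it contains some linear order together with its reverse. Let $g(n)$ be the maximal cardinality of a peak-pit domain on $n$ alternatives. Fishburn's domain $F_n$ is the set of all linear orders on $\{1,\dots,n\}$ such that for all $i<j<k$ the alternative $j$ is never ranked last among $i,j,k$ if $j$ is even, and never ranked first among $i,j,k$ if $j$ is odd. For domains $\mathcal D_1,\mathcal D_2$ on disjoint sets $A,B$ and $u\in\mathcal D_1$, $v\in\mathcal D_2$, let $$(\mathcal D_1\otimes\mathcal D_2)(u,v)=\{xy\mid x\in\mathcal D_1,\ y\in\mathcal D_2\}\cup\{w\in\mathcal L(A\cup B)\mid w|_A=u,\ w|_B=v\},$$ where $xy$ ranks all of $A$, ordered by $x$, above all of $B$, ordered by $y$. For every $n$ one can choose $u,v\in F_n$ (the second in a disjoint copy of $F_n$) such that $(F_n\otimes F_n)(u,v)$ has maximal width. Write $F_n\otimes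 F_n$ for $(F_n\otimes F_n)(u,v)$ with any such choice of $u,v$. Then: 1. $|F_n\otimes F_n|<|F_{2n}|$ for $2<n\le 19$. 2. $F_{20}\otimes F_{20}$ is a peak-pit Condorcet domain on $40$ alternatives, and $$|F_{20}\otimes F_{20}|=4611858343415>4549082342996=|F_{40}|.$$ 3. Consequently $g(40)>|F_{40}|$, that is, $F_{40}$ is not a largest peak-pit domain on $40$ alternatives. -/

import Mathlib

/-- A strict linear order on a set of alternatives `A`; `u.prefers a b` means that `u` ranks
`a` above `b`. -/
@[ext]
structure StrictRanking (A : Type*) where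
  prefers : A → A → Prop
  irrefl : ∀ a, ¬ prefers a a
  trans : ∀ a b c, prefers a b → prefers b c → prefers a c
  total : ∀ a b, a ≠ b → prefers a b ∨ prefers b a

namespace StrictRanking

/-- The completely reversed order (the flip). -/
def flip {A : Type*} (u : StrictRanking A) : StrictRanking A where
  prefers a b := u.prefers b a
  irrefl a := u.irrefl a
  trans a b c hab hbc := u.trans c b a hbc hab
  total a b h := (u.total a b h).symm

/-- The restriction of a linear order along an embedding of a set of alternatives. -/
def restrict {A C : Type*} (f : A ↪ C) (w : StrictRanking C) : StrictRanking A where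
  prefers a b := w.prefers (f a) (f b)
  irrefl a := w.irrefl (f a)
  trans a b c := w.trans (f a) (f b) (f c)
  total a b h := w.total (f a) (f b) (f.injective.ne h)

/-- The order `xy` on the disjoint union of `A` and `B`: first all of `A`, ranked by `x`, then
all of `B`, ranked by `y`. -/
def concat {A B : Type*} (x : StrictRanking A) (y : StrictRanking B) : StrictRanking (A ⊕ B) where
  prefers := Sum.Lex x.prefers y.prefers
  irrefl := by
    rintro (a | b) h
    · exact x.irrefl a (Sum.lex_inl_inl.mp h)
    · exact y.irrefl b (Sum.lex_inr_inr.mp h)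
  trans := by
    rintro _ _ _ (h | h | _) (k | k | _)
    · exact .inl (x.trans _ _ _ h k)
    · exact .sep _ _
    · exact .inr (y.trans _ _ _ h k)
    · exact .sep _ _
  total := by
    rintro (a | a) (b | b) h
    · exact (x.total a b fun e => h (e ▸ rfl)).imp .inl .inl
    · exact .inl (.sep _ _)
    · exact .inr (.sep _ _)
    · exact (y.total a b fun e => h (e ▸ rfl)).imp .inr .inr

instance {A : Type*} [Finite A] : Finite (StrictRanking A) :=
  Finite.of_injective StrictRanking.prefers fun _ _ h => StrictRanking.ext h

end StrictRanking

/-- The strict majority relation of a profile of `k` linear orders. -/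
def majority {A : Type*} {k : ℕ} (P : Fin k → StrictRanking A) (a b : A) : Prop :=
  {i | (P i).prefers b a}.ncard < {i | (P i).prefers a b}.ncard

/-- A Condorcet domain: a non-empty set of linear orders such that the majority relation of every
profile over it with an odd number of voters is transitive. -/
def IsCondorcetDomain {A : Type*} (D : Set (StrictRanking A)) : Prop :=
  D.Nonempty ∧ ∀ (k : ℕ) (P : Fin k → StrictRanking A), Odd k → (∀ i, P i ∈ D) →
    ∀ a b c : A, majority P a b → majority P b c → majority P a c

/-- `x` is never ranked first among the three alternatives `x, y, z`. -/
def NeverFirst {A : Type*} (D : Set (StrictRanking A)) (x y z : A) : Prop :=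
  ∀ u ∈ D, ¬ (u.prefers x y ∧ u.prefers x z)

/-- `x` is never ranked last among the three alternatives `x, y, z`. -/
def NeverLast {A : Type*} (D : Set (StrictRanking A)) (x y z : A) : Prop :=
  ∀ u ∈ D, ¬ (u.prefers y x ∧ u.prefers z x)

/-- A peak-pit domain: in every triple of alternatives some alternative is never ranked first, or
some alternative is never ranked last. -/
def IsPeakPit {A : Type*} (D : Set (StrictRanking A)) : Prop :=
  ∀ a b c : A, a ≠ b → a ≠ c → b ≠ c →
    (NeverFirst D a b c ∨ NeverFirst D b a c ∨ NeverFirst D c a b) ∨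
    (NeverLast D a b c ∨ NeverLast D b a c ∨ NeverLast D c a b)

/-- A domain of maximal width contains two completely reversed orders. -/
def HasMaximalWidth {A : Type*} (D : Set (StrictRanking A)) : Prop :=
  ∃ u ∈ D, u.flip ∈ D

/-- Fishburn's alternating-scheme domain. The element `j : Fin n` stands for the alternative
`j + 1` of `{1, …, n}`: in triples `i < j < k` the alternative `j` is never last if its label is
even, and never first if its label is odd. -/
def fishburn (n : ℕ) : Set (StrictRanking (Fin n)) :=
  {u | ∀ i j k : Fin n, i < j → j < k →
    (Even (j.val + 1) → ¬ (u.prefers i j ∧ u.prefers k j)) ∧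
    (Odd (j.val + 1) → ¬ (u.prefers j i ∧ u.prefers j k))}

/-- The concatenation of two domains on disjoint sets of alternatives. -/
def concatDomain {A B : Type*} (D₁ : Set (StrictRanking A)) (D₂ : Set (StrictRanking B)) :
    Set (StrictRanking (A ⊕ B)) :=
  {w | ∃ x ∈ D₁, ∃ y ∈ D₂, w = x.concat y}

/-- The set of all shuffles of two linear orders on disjoint sets of alternatives. -/
def shuffles {A B : Type*} (u : StrictRanking A) (v : StrictRanking B) : Set (StrictRanking (A ⊕ B)) :=
  {w | w.restrict Function.Embedding.inl = u ∧ w.restrict Function.Embedding.inr = v}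

/-- The composition `(D₁ ⊗ D₂)(u, v)`. -/
def compose {A B : Type*} (D₁ : Set (StrictRanking A)) (D₂ : Set (StrictRanking B))
    (u : StrictRanking A) (v : StrictRanking B) : Set (StrictRanking (A ⊕ B)) :=
  concatDomain D₁ D₂ ∪ shuffles u v

/-- The sizes of the peak-pit domains on `n` alternatives. -/
def peakPitSizes (n : ℕ) : Set ℕ :=
  {k | ∃ D : Set (StrictRanking (Fin n)), IsPeakPit D ∧ D.ncard = k}

/-- The maximal size `g(n)` of a peak-pit domain on `n` alternatives. -/
noncomputable def maxPeakPit (n : ℕ) : ℕ := sSup (peakPitSizes n)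

/-- The supremum is a maximum. -/
theorem maxPeakPit_isGreatest (n : ℕ) : IsGreatest (peakPitSizes n) (maxPeakPit n) := by
  have hb : BddAbove (peakPitSizes n) := by
    refine ⟨Nat.card (StrictRanking (Fin n)), ?_⟩
    rintro k ⟨D, -, rfl⟩
    exact Set.ncard_le_card D
  have hne : (peakPitSizes n).Nonempty :=
    ⟨0, ∅, fun _ _ _ _ _ _ => .inl (.inl fun _ h => h.elim), by simp⟩
  exact ⟨Nat.sSup_mem hne hb, fun k hk => le_csSup hb hk⟩

/-! A linear order is determined by the chain of its initial segments. Both `fishburn n` and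
`shuffles u v` consist of the orders whose proper initial segments all lie in a fixed family of sets
(`fishburn_eq`, `shuffles_eq`), so their sizes are numbers of maximal chains, computed by the
recursion `chainCount` (`ncard_setOf_forall_adm`).

For shuffles the recursion is Pascal's rule. For Fishburn's domain, arrange the alternatives on a
circle as `…, 5, 3, 1, 2, 4, 6, …`: the nonempty proper sets in an admissible chain are arcs `[lo,
hi]`, each obtained from the previous one by growing at one end. Then `lo + hi` changes by `±1` and
stays in `0, …, n + 1`, starting at the even value `2 * i` of a one-point arc; the size is a number
of walks on a path graph (`ncard_fishburn`).

Concatenations and shuffles share only the order `uv`, so the composition has `|F_n|² + (2n choose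
n) - 1` elements (`ncard_compose_fishburn`). It is peak-pit because every mixed triple satisfies a
never condition (`isPeakPit_compose`), and peak-pit domains are Condorcet. The rest is a finite
computation. -/

/-! ### Counting orders by chains of initial segments. -/

/-- The linear orders that extend the order `v` on the initial segment `X` in such a way that all
initial segments `{x | x above a}` with `a` outside `X` are admissible. -/
def completions {A : Type*} (Adm : Set A → Prop) (X : Set A) (v : StrictRanking A) :
    Set (StrictRanking A) :=
  {u | (∀ a ∉ X, Adm {x | u.prefers x a}) ∧ (∀ a ∈ X, ∀ b ∉ X, u.prefers a b) ∧
    ∀ a ∈ X, ∀ b ∈ X, (u.prefers a b ↔ v.prefers a b)}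

open Classical in
/-- The number of ways to add the `k` elements outside `X` one by one to `X` so that all
intermediate sets except the last one are admissible. -/
noncomputable def chainCount {A : Type*} [Fintype A] (Adm : Set A → Prop) :
    ℕ → Finset A → ℕ
  | 0, _ => 1
  | k + 1, X => if Adm X then ∑ x ∈ Xᶜ, chainCount Adm k (insert x X) else 0

namespace StrictRanking

variable {A : Type*} (u : StrictRanking A)

theorem asymm {a b : A} (h : u.prefers a b) : ¬ u.prefers b a :=
  fun h' => u.irrefl a (u.trans _ _ _ h h')

theorem ne_of_prefers {a b : A} (h : u.prefers a b) : a ≠ b := by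
  rintro rfl
  exact u.irrefl a h

/-- A nonempty finite set of alternatives has a top element. -/
theorem exists_top (s : Finset A) (hs : s.Nonempty) :
    ∃ a ∈ s, ∀ b ∈ s, b ≠ a → u.prefers a b := by
  classical
  induction hs using Finset.Nonempty.cons_induction with
  | singleton a => exact ⟨a, by simp, by simp⟩
  | cons a s ha hs ih =>
    obtain ⟨t, hts, ht⟩ := ih
    have hat : a ≠ t := fun h => ha (h ▸ hts)
    rcases u.total a t hat with h | h
    · refine ⟨a, by simp, fun b hb hba => ?_⟩
      have hb' : b ∈ s := (Finset.mem_cons.mp hb).resolve_left hba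
      by_cases hbt : b = t
      · exact hbt ▸ h
      · exact u.trans _ _ _ h (ht b hb' hbt)
    · refine ⟨t, by simp [hts], fun b hb hbt => ?_⟩
      rcases Finset.mem_cons.mp hb with rfl | hb'
      · exact h
      · exact ht b hb' hbt

/-- The order obtained by moving `x` to the bottom. -/
def toBottom (x : A) : StrictRanking A where
  prefers a b := a ≠ x ∧ (b = x ∨ u.prefers a b)
  irrefl a h := h.2.elim h.1 (u.irrefl a)
  trans a b c hab hbc := ⟨hab.1, hbc.2.imp_right
    fun h => u.trans _ _ _ (hab.2.resolve_left hbc.1) h⟩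
  total a b hab := by
    by_cases ha : a = x
    · exact .inr ⟨fun hb => hab (ha.trans hb.symm), .inl ha⟩
    · by_cases hb : b = x
      · exact .inl ⟨ha, .inl hb⟩
      · exact (u.total a b hab).imp (fun h => ⟨ha, .inr h⟩) fun h => ⟨hb, .inr h⟩

end StrictRanking

section Completions

variable {A : Type*} {Adm : Set A → Prop}

theorem completions_univ (v : StrictRanking A) : completions Adm Set.univ v = {v} := by
  ext u
  simp only [completions, Set.mem_univ, not_true_eq_false, false_imp_iff, implies_true,
    true_imp_iff, true_and, Set.mem_ofPred_eq, Set.mem_singleton_iff]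
  exact ⟨fun h => StrictRanking.ext (funext₂ fun a b => propext (h a b)),
    fun h a b => h ▸ Iff.rfl⟩

/-- The initial segment above the top element of the complement of an initial segment `X`
is `X`. -/
theorem setOf_prefers_eq {X : Set A} {u : StrictRanking A} (hX : ∀ a ∈ X, ∀ b ∉ X, u.prefers a b)
    {x : A} (hx : x ∉ X) (htop : ∀ b ∉ X, b ≠ x → u.prefers x b) : {y | u.prefers y x} = X := by
  ext y
  refine ⟨fun hy => ?_, fun hy => hX y hy x hx⟩
  by_contra hyX
  exact u.asymm hy (htop y hyX (u.ne_of_prefers hy))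

theorem exists_top_compl [Fintype A] {X : Finset A} (hX : X ≠ Finset.univ) (u : StrictRanking A) :
    ∃ x ∉ X, ∀ b ∉ X, b ≠ x → u.prefers x b := by
  classical
  obtain ⟨x, hx, h⟩ := u.exists_top Xᶜ (by
    rw [Finset.nonempty_iff_ne_empty]
    simpa using hX)
  exact ⟨x, by simpa using hx, fun b hb => h b (by simpa using hb)⟩

theorem completions_eq_empty [Fintype A] {X : Finset A} (hX : X ≠ Finset.univ) (hAdm : ¬ Adm X)
    (v : StrictRanking A) : completions Adm X v = ∅ := by
  ext u
  simp only [Set.mem_empty_iff_false, iff_false]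
  rintro ⟨h₁, h₂, -⟩
  obtain ⟨x, hx, htop⟩ := exists_top_compl hX u
  have := h₁ x (by simpa using hx)
  rw [setOf_prefers_eq h₂ (by simpa using hx) (by simpa using htop)] at this
  exact hAdm this

open Classical in
theorem completions_eq_iUnion [Fintype A] {X : Finset A} (hX : X ≠ Finset.univ) (hAdm : Adm X)
    (v : StrictRanking A) :
    completions Adm X v = ⋃ x ∈ Xᶜ, completions Adm (insert x X : Finset A) (v.toBottom x) := by
  ext u
  simp only [Set.mem_iUnion, Finset.mem_compl, exists_prop]
  constructor
  · rintro ⟨h₁, h₂, h₃⟩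
    obtain ⟨x, hx, htop⟩ := exists_top_compl hX u
    refine ⟨x, hx, fun a ha => h₁ a fun h => ha (by simp_all), fun a ha b hb => ?_,
      fun a ha b hb => ?_⟩
    · simp only [Finset.coe_insert, Set.mem_insert_iff, not_or, Finset.mem_coe] at ha hb
      rcases ha with rfl | ha
      · exact htop b hb.2 hb.1
      · exact h₂ a ha b hb.2
    · simp only [Finset.coe_insert, Set.mem_insert_iff, Finset.mem_coe] at ha hb
      simp only [StrictRanking.toBottom]
      rcases ha with rfl | ha
      · simp only [ne_eq, not_true_eq_false, false_and, iff_false]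
        rcases hb with rfl | hb
        · exact u.irrefl _
        · exact u.asymm (h₂ b hb a (by simpa using hx))
      · have hax : a ≠ x := fun h => hx (h ▸ ha)
        rcases hb with rfl | hb
        · simpa [hax] using h₂ a ha b (by simpa using hx)
        · have hbx : b ≠ x := fun h => hx (h ▸ hb)
          simpa [hax, hbx] using h₃ a ha b hb
  · rintro ⟨x, hx, h₁, h₂, h₃⟩
    simp only [Finset.coe_insert, Set.mem_insert_iff, Finset.mem_coe, not_or] at h₁ h₂ h₃
    have key : ∀ a ∈ (X : Set A), ∀ b ∉ (X : Set A), u.prefers a b := by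
      intro a ha b hb
      have hax : a ≠ x := fun h => hx (h ▸ ha)
      by_cases hbx : b = x
      · exact (h₃ a (.inr ha) b (.inl hbx)).mpr ⟨hax, .inl hbx⟩
      · exact h₂ a (.inr ha) b ⟨hbx, hb⟩
    refine ⟨fun a ha => ?_, key, fun a ha b hb => ?_⟩
    · by_cases hax : a = x
      · subst hax
        rw [setOf_prefers_eq key ha fun b hb hba => h₂ a (.inl rfl) b ⟨hba, hb⟩]
        exact hAdm
      · exact h₁ a ⟨hax, ha⟩
    · have hax : a ≠ x := fun h => hx (h ▸ ha)
      have hbx : b ≠ x := fun h => hx (h ▸ hb)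
      simpa [StrictRanking.toBottom, hax, hbx] using h₃ a (.inr ha) b (.inr hb)

/-- Completions are classified by the element ranked directly below `X`; the classes are disjoint.
The full set is never tested, since no alternative lies above itself. -/
theorem ncard_completions [Fintype A] (k : ℕ) (X : Finset A) (hk : X.card + k = Fintype.card A)
    (v : StrictRanking A) : (completions Adm X v).ncard = chainCount Adm k X := by
  classical
  induction k generalizing X v with
  | zero =>
    obtain rfl : X = Finset.univ := Finset.card_eq_iff_eq_univ X |>.mp hk
    rw [Finset.coe_univ, completions_univ, Set.ncard_singleton, chainCount]
  | succ k ih =>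
    have hX : X ≠ Finset.univ := by
      rintro rfl
      rw [Finset.card_univ] at hk
      omega
    rw [chainCount]
    split_ifs with hAdm
    · rw [completions_eq_iUnion hX hAdm, ← Finset.sum_congr rfl fun x hx => ih (insert x X) (by
        rw [Finset.card_insert_of_notMem (by simpa using hx)]; omega) (v.toBottom x)]
      rw [← finsum_mem_coe_finset, ← Set.Finite.ncard_biUnion (Finset.finite_toSet _)
        fun _ _ => Set.toFinite _]
      · simp only [Finset.mem_coe]
      · intro x hx y hy hxy
        rw [Function.onFun, Set.disjoint_left]
        rintro u ⟨-, hu, -⟩ ⟨-, hu', -⟩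
        simp only [Finset.mem_coe, Finset.mem_compl] at hx hy
        exact u.asymm (hu x (by simp) y (by simp [hy, Ne.symm hxy]))
          (hu' y (by simp) x (by simp [hx, hxy]))
    · rw [completions_eq_empty hX hAdm, Set.ncard_empty]

theorem ncard_setOf_forall_adm [Fintype A] (v : StrictRanking A) :
    {u : StrictRanking A | ∀ a, Adm {x | u.prefers x a}}.ncard =
      chainCount Adm (Fintype.card A) ∅ := by
  rw [← ncard_completions (Fintype.card A) ∅ (by simp) v]
  congr 1
  ext u
  simp [completions]

end Completions

/-! ### Peak-pit domains are Condorcet domains. -/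

section Condorcet

variable {A : Type*}

/-- Contrapositively, a voter with `d` above `c` has `b` above `a`; so supporters can only be gained
and opponents only lost. -/
theorem majority_mono {k : ℕ} {P : Fin k → StrictRanking A} {a b c d : A} (hab : a ≠ b)
    (h : ∀ i, (P i).prefers a b → (P i).prefers c d) (hm : majority P a b) : majority P c d := by
  unfold majority at *
  refine (Set.ncard_le_ncard ?_ (Set.toFinite _)).trans_lt
    (hm.trans_le (Set.ncard_le_ncard (fun i hi => h i hi) (Set.toFinite _)))
  intro i hi
  by_contra hba
  exact (P i).asymm hi (h i (((P i).total a b hab).resolve_right hba))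

/-- Under each never condition, one preference of a voter forces another, and `majority_mono` lifts
this to majorities. Four cases yield `a` over `c`; "`a` never first" and "`c` never last" reverse
one of the given majorities. -/
theorem IsPeakPit.isCondorcetDomain {D : Set (StrictRanking A)} (hD : IsPeakPit D)
    (hne : D.Nonempty) : IsCondorcetDomain D := by
  refine ⟨hne, fun k P _ hP a b c hab hbc => ?_⟩
  have irr : ∀ x, ¬ majority P x x := fun x h => lt_irrefl _ h
  have nab : a ≠ b := fun h => irr b (h ▸ hab)
  have nbc : b ≠ c := fun h => irr c (h ▸ hbc)
  have asym : ∀ x y, majority P x y → ¬ majority P y x := fun x y h h' => lt_asymm h h'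
  have nac : a ≠ c := fun h => asym _ _ hab (h ▸ hbc)
  have tr := fun i => (P i).trans
  have tot := fun i => (P i).total
  rcases hD a b c nab nac nbc with (h | h | h) | (h | h | h)
  · refine absurd (majority_mono nab (fun i hi => ?_) hab) (asym _ _ hbc)
    have := h _ (hP i)
    exact tr i _ _ _ ((tot i a c nac).resolve_left fun h' => this ⟨hi, h'⟩) hi
  · refine majority_mono nbc (fun i hi => ?_) hbc
    have := h _ (hP i)
    exact tr i _ _ _ ((tot i a b nab).resolve_right fun h' => this ⟨h', hi⟩) hi
  · refine majority_mono nab (fun i hi => ?_) hab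
    have := h _ (hP i)
    exact (tot i a c nac).resolve_right fun h' => this ⟨h', tr i _ _ _ h' hi⟩
  · refine majority_mono nbc (fun i hi => ?_) hbc
    have := h _ (hP i)
    exact (tot i a c nac).resolve_right fun h' => this ⟨tr i _ _ _ hi h', h'⟩
  · refine majority_mono nab (fun i hi => ?_) hab
    have := h _ (hP i)
    exact tr i _ _ _ hi ((tot i b c nbc).resolve_right fun h' => this ⟨hi, h'⟩)
  · refine absurd (majority_mono nbc (fun i hi => ?_) hbc) (asym _ _ hab)
    have := h _ (hP i)
    exact tr i _ _ _ hi ((tot i a c nac).resolve_left fun h' => this ⟨h', hi⟩)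

end Condorcet

/-! ### The composition: width, size, never conditions. -/

section Compose

variable {A B : Type*}

theorem fishburn_isPeakPit (n : ℕ) : IsPeakPit (fishburn n) := by
  have main : ∀ i j k : Fin n, i < j → j < k →
      NeverFirst (fishburn n) j i k ∨ NeverLast (fishburn n) j i k := by
    intro i j k hij hjk
    rcases Nat.even_or_odd (j.val + 1) with h | h
    · exact .inr fun u hu => (hu i j k hij hjk).1 h
    · exact .inl fun u hu => (hu i j k hij hjk).2 h
  have swap₁ : ∀ a b c, NeverFirst (fishburn n) a b c → NeverFirst (fishburn n) a c b :=
    fun a b c h u hu h' => h u hu h'.symm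
  have swap₂ : ∀ a b c, NeverLast (fishburn n) a b c → NeverLast (fishburn n) a c b :=
    fun a b c h u hu h' => h u hu h'.symm
  intro a b c hab hac hbc
  rcases lt_or_gt_of_ne hab with h₁ | h₁ <;> rcases lt_or_gt_of_ne hac with h₂ | h₂ <;>
    rcases lt_or_gt_of_ne hbc with h₃ | h₃
  · exact (main _ _ _ h₁ h₃).imp (fun h => .inr (.inl h)) fun h => .inr (.inl h)
  · exact (main _ _ _ h₂ h₃).imp (fun h => .inr (.inr h)) fun h => .inr (.inr h)
  · exact absurd (h₁.trans h₃) (not_lt_of_gt h₂)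
  · exact (main _ _ _ h₂ h₁).imp (fun h => .inl (swap₁ _ _ _ h)) fun h => .inl (swap₂ _ _ _ h)
  · exact (main _ _ _ h₁ h₂).imp .inl .inl
  · exact absurd (h₁.trans h₂) (not_lt_of_gt h₃)
  · exact (main _ _ _ h₃ h₂).imp (fun h => .inr (.inr (swap₁ _ _ _ h)))
      fun h => .inr (.inr (swap₂ _ _ _ h))
  · exact (main _ _ _ h₃ h₁).imp (fun h => .inr (.inl (swap₁ _ _ _ h)))
      fun h => .inr (.inl (swap₂ _ _ _ h))

/-- The order `1, 2, …, n`. -/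
def StrictRanking.ofLT (n : ℕ) : StrictRanking (Fin n) where
  prefers a b := a < b
  irrefl a := lt_irrefl a
  trans _ _ _ := lt_trans
  total _ _ := lt_or_gt_of_ne

theorem ofLT_mem_fishburn (n : ℕ) : StrictRanking.ofLT n ∈ fishburn n :=
  fun _ _ _ hij hjk => ⟨fun _ h => lt_asymm hjk h.2, fun _ h => lt_asymm hij h.1⟩

theorem flip_ofLT_mem_fishburn (n : ℕ) : (StrictRanking.ofLT n).flip ∈ fishburn n :=
  fun _ _ _ hij hjk => ⟨fun _ h => lt_asymm hij h.1, fun _ h => lt_asymm hjk h.2⟩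

theorem restrict_inl_concat (x : StrictRanking A) (y : StrictRanking B) :
    (x.concat y).restrict Function.Embedding.inl = x := by
  ext a b
  exact Sum.lex_inl_inl

theorem restrict_inr_concat (x : StrictRanking A) (y : StrictRanking B) :
    (x.concat y).restrict Function.Embedding.inr = y := by
  ext a b
  exact Sum.lex_inr_inr

theorem hasMaximalWidth_compose {D₁ : Set (StrictRanking A)} {D₂ : Set (StrictRanking B)}
    {u : StrictRanking A} {v : StrictRanking B} (hu : u.flip ∈ D₁) (hv : v.flip ∈ D₂) :
    HasMaximalWidth (compose D₁ D₂ u v) := by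
  -- The reverse of this concatenation restricts to `u` and `v`, hence is a shuffle.
  refine ⟨u.flip.concat v.flip, .inl ⟨_, hu, _, hv, rfl⟩, .inr ⟨?_, ?_⟩⟩
  · ext a b
    exact Sum.lex_inl_inl
  · ext a b
    exact Sum.lex_inr_inr

theorem ncard_concatDomain (D₁ : Set (StrictRanking A)) (D₂ : Set (StrictRanking B)) :
    (concatDomain D₁ D₂).ncard = D₁.ncard * D₂.ncard := by
  rw [← Set.ncard_prod]
  have : concatDomain D₁ D₂ = (fun p => p.1.concat p.2) '' (D₁ ×ˢ D₂) := by
    ext w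
    constructor
    · rintro ⟨x, hx, y, hy, rfl⟩
      exact ⟨(x, y), ⟨hx, hy⟩, rfl⟩
    · rintro ⟨p, hp, rfl⟩
      exact ⟨p.1, hp.1, p.2, hp.2, rfl⟩
  rw [this, Set.ncard_image_of_injective]
  intro p q h
  have h₁ := congrArg (StrictRanking.restrict Function.Embedding.inl) h
  have h₂ := congrArg (StrictRanking.restrict Function.Embedding.inr) h
  simp only [restrict_inl_concat, restrict_inr_concat] at h₁ h₂
  exact Prod.ext h₁ h₂

theorem ncard_compose [Finite A] [Finite B] {D₁ : Set (StrictRanking A)}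
    {D₂ : Set (StrictRanking B)} {u : StrictRanking A} {v : StrictRanking B} (hu : u ∈ D₁)
    (hv : v ∈ D₂) :
    (compose D₁ D₂ u v).ncard + 1 = D₁.ncard * D₂.ncard + (shuffles u v).ncard := by
  have : concatDomain D₁ D₂ ∩ shuffles u v = {u.concat v} := by
    ext w
    constructor
    · rintro ⟨⟨x, hx, y, hy, rfl⟩, h₁, h₂⟩
      rw [restrict_inl_concat] at h₁
      rw [restrict_inr_concat] at h₂
      rw [h₁, h₂, Set.mem_singleton_iff]
    · rintro rfl
      exact ⟨⟨u, hu, v, hv, rfl⟩, restrict_inl_concat u v, restrict_inr_concat u v⟩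
  rw [← ncard_concatDomain, ← Set.ncard_union_add_ncard_inter, this, Set.ncard_singleton, compose]

/-- In a triple with two alternatives from `A`, the one that `u` prefers is never last: it beats the
other in shuffles and the element of `B` in concatenations. Dually, of two alternatives from `B` the
one lower in `v` is never first. -/
theorem isPeakPit_compose {D₁ : Set (StrictRanking A)} {D₂ : Set (StrictRanking B)}
    (h₁ : IsPeakPit D₁) (h₂ : IsPeakPit D₂) {u : StrictRanking A} {v : StrictRanking B}
    (hu : u ∈ D₁) (hv : v ∈ D₂) : IsPeakPit (compose D₁ D₂ u v) := by
  set D := compose D₁ D₂ u v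
  have hA : ∀ w ∈ D, w.restrict Function.Embedding.inl ∈ D₁ := by
    rintro w (⟨x, hx, y, hy, rfl⟩ | ⟨h, -⟩)
    · rwa [restrict_inl_concat]
    · rwa [h]
  have hB : ∀ w ∈ D, w.restrict Function.Embedding.inr ∈ D₂ := by
    rintro w (⟨x, hx, y, hy, rfl⟩ | ⟨-, h⟩)
    · rwa [restrict_inr_concat]
    · rwa [h]
  have swap₁ : ∀ a b c, NeverFirst D a b c → NeverFirst D a c b :=
    fun a b c h u hu h' => h u hu h'.symm
  have swap₂ : ∀ a b c, NeverLast D a b c → NeverLast D a c b :=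
    fun a b c h u hu h' => h u hu h'.symm
  have hAB : ∀ a a' : A, ∀ b : B, Sum.inl a ≠ (Sum.inl a' : A ⊕ B) →
      NeverLast D (.inl a) (.inl a') (.inr b) ∨ NeverLast D (.inl a') (.inl a) (.inr b) := by
    have key : ∀ a a' : A, ∀ b : B, u.prefers a a' →
        NeverLast D (.inl a) (.inl a') (.inr b) := by
      rintro a a' b haa w (⟨x, -, y, -, rfl⟩ | ⟨h, -⟩) ⟨h₁, h₂⟩
      · exact Sum.lex_inr_inl h₂
      · rw [← h] at haa
        exact w.asymm haa h₁
    intro a a' b haa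
    exact (u.total a a' fun h => haa (h ▸ rfl)).imp (key _ _ _) (key _ _ _)
  have hBA : ∀ b b' : B, ∀ a : A, Sum.inr b ≠ (Sum.inr b' : A ⊕ B) →
      NeverFirst D (.inr b) (.inr b') (.inl a) ∨ NeverFirst D (.inr b') (.inr b) (.inl a) := by
    have key : ∀ b b' : B, ∀ a : A, v.prefers b b' →
        NeverFirst D (.inr b') (.inr b) (.inl a) := by
      rintro b b' a hbb w (⟨x, -, y, -, rfl⟩ | ⟨-, h⟩) ⟨h₁, h₂⟩
      · exact Sum.lex_inr_inl h₂
      · rw [← h] at hbb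
        exact w.asymm hbb h₁
    intro b b' a hbb
    exact (v.total b b' fun h => hbb (h ▸ rfl)).symm.imp (key _ _ _) (key _ _ _)
  rintro (a | a) (b | b) (c | c) hab hac hbc
  · exact (h₁ a b c (fun h => hab (h ▸ rfl)) (fun h => hac (h ▸ rfl)) (fun h => hbc (h ▸ rfl))).imp
      (Or.imp (fun h w hw => h _ (hA w hw))
        (Or.imp (fun h w hw => h _ (hA w hw)) fun h w hw => h _ (hA w hw)))
      (Or.imp (fun h w hw => h _ (hA w hw))
        (Or.imp (fun h w hw => h _ (hA w hw)) fun h w hw => h _ (hA w hw)))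
  · exact .inr ((hAB a b c hab).imp id .inl)
  · exact .inr ((hAB a c b hac).imp (swap₂ _ _ _) .inr)
  · exact .inl (.inr ((hBA b c a hbc).imp (swap₁ _ _ _) (swap₁ _ _ _)))
  · exact .inr (.inr ((hAB b c a hbc).imp (swap₂ _ _ _) (swap₂ _ _ _)))
  · exact .inl ((hBA a c b hac).imp (swap₁ _ _ _) .inr)
  · exact .inl ((hBA a b c hab).imp id .inl)
  · exact (h₂ a b c (fun h => hab (h ▸ rfl)) (fun h => hac (h ▸ rfl)) (fun h => hbc (h ▸ rfl))).imp
      (Or.imp (fun h w hw => h _ (hB w hw))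
        (Or.imp (fun h w hw => h _ (hB w hw)) fun h w hw => h _ (hB w hw)))
      (Or.imp (fun h w hw => h _ (hB w hw))
        (Or.imp (fun h w hw => h _ (hB w hw)) fun h w hw => h _ (hB w hw)))

/-- Serves to transport a domain on a sum type to `Fin n`, where `maxPeakPit` lives. -/
theorem IsPeakPit.image_restrict {D : Set (StrictRanking B)} (hD : IsPeakPit D) (f : A ↪ B) :
    IsPeakPit (StrictRanking.restrict f '' D) := by
  intro a b c hab hac hbc
  have hF : ∀ x y z, NeverFirst D (f x) (f y) (f z) →
      NeverFirst (StrictRanking.restrict f '' D) x y z := by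
    rintro x y z h _ ⟨u, hu, rfl⟩
    exact h u hu
  have hL : ∀ x y z, NeverLast D (f x) (f y) (f z) →
      NeverLast (StrictRanking.restrict f '' D) x y z := by
    rintro x y z h _ ⟨u, hu, rfl⟩
    exact h u hu
  exact (hD _ _ _ (f.injective.ne hab) (f.injective.ne hac) (f.injective.ne hbc)).imp
    (Or.imp (hF _ _ _) (Or.imp (hF _ _ _) (hF _ _ _)))
    (Or.imp (hL _ _ _) (Or.imp (hL _ _ _) (hL _ _ _)))

theorem restrict_equiv_injective (e : A ≃ B) :
    Function.Injective (StrictRanking.restrict e.toEmbedding) := by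
  intro u v h
  ext a b
  have := congrArg (fun w => w.prefers (e.symm a) (e.symm b)) h
  simpa [StrictRanking.restrict] using this.to_iff

end Compose

/-! ### Counting shuffles. -/

theorem chainCount_eq_zero {A : Type*} [Fintype A] {Adm : Set A → Prop} {k : ℕ} {X : Finset A}
    (hk : k ≠ 0) (hX : ¬ Adm X) : chainCount Adm k X = 0 := by
  obtain ⟨k, rfl⟩ := Nat.exists_eq_succ_of_ne_zero hk
  rw [chainCount, if_neg hX]

theorem chainCount_succ {A : Type*} [Fintype A] [DecidableEq A] {Adm : Set A → Prop}
    {X : Finset A} (hX : Adm X) (k : ℕ) :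
    chainCount Adm (k + 1) X = ∑ x ∈ Xᶜ, chainCount Adm k (insert x X) := by
  rw [chainCount, if_pos hX]
  congr!

section Shuffles

variable {A B : Type*}

/-- The sets whose parts in `A` and in `B` are initial segments of `u` and `v`. -/
def IsShuffleSegment (u : StrictRanking A) (v : StrictRanking B) (X : Set (A ⊕ B)) : Prop :=
  (∀ a b, u.prefers a b → Sum.inl b ∈ X → Sum.inl a ∈ X) ∧
    ∀ a b, v.prefers a b → Sum.inr b ∈ X → Sum.inr a ∈ X

theorem restrict_eq_iff (f : A ↪ B) (w : StrictRanking B) (u : StrictRanking A) :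
    w.restrict f = u ↔ ∀ a b, u.prefers a b → w.prefers (f a) (f b) := by
  constructor
  · rintro rfl a b h
    exact h
  · intro h
    ext a b
    refine ⟨fun hab => ?_, h a b⟩
    by_contra hu
    rcases u.total a b (fun e => w.irrefl (f a) (by nth_rw 2 [e]; exact hab)) with h' | h'
    · exact hu h'
    · exact w.asymm hab (h _ _ h')

theorem forall_segment_iff (f : A ↪ B) (w : StrictRanking B) (u : StrictRanking A) :
    (∀ z, ∀ a b, u.prefers a b → w.prefers (f b) z → w.prefers (f a) z) ↔
      w.restrict f = u := by
  rw [restrict_eq_iff]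
  refine ⟨fun h a b hab => ?_, fun h z a b hab hb => w.trans _ _ _ (h a b hab) hb⟩
  by_contra hw
  have := (w.total _ _ (f.injective.ne (u.ne_of_prefers hab))).resolve_left hw
  exact w.irrefl _ (h _ a b hab this)

theorem shuffles_eq (u : StrictRanking A) (v : StrictRanking B) :
    shuffles u v = {w | ∀ z, IsShuffleSegment u v {x | w.prefers x z}} := by
  ext w
  rw [shuffles, Set.mem_ofPred_eq, ← forall_segment_iff, ← forall_segment_iff]
  exact ⟨fun h z => ⟨h.1 z, h.2 z⟩, fun h => ⟨fun z => (h z).1, fun z => (h z).2⟩⟩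

variable [Fintype A] [Fintype B] {u : StrictRanking A} {v : StrictRanking B}

-- Only the top remaining element of `A` or of `B` can come next; these two choices give the two
-- terms of Pascal's rule.
open Classical in
theorem chainCount_isShuffleSegment (k : ℕ) (X : Finset (A ⊕ B))
    (hX : IsShuffleSegment u v X) (hk : Xᶜ.card = k) :
    chainCount (IsShuffleSegment u v) k X = k.choose Xᶜ.toLeft.card := by
  induction k generalizing X with
  | zero =>
    have := Xᶜ.card_toLeft_add_card_toRight
    rw [show Xᶜ.toLeft.card = 0 by omega, chainCount, Nat.choose_zero_right]
  | succ k ih =>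
    have hcard := Xᶜ.card_toLeft_add_card_toRight
    have hins : ∀ x ∉ X, (insert x X)ᶜ.card = k := fun x hx => by
      rw [Finset.compl_insert, Finset.card_erase_of_mem (by simpa using hx), hk]
      rfl
    -- `chainCount` does not test the last set, so a wrong choice contributes zero only when `k ≠
    -- 0`; two distinct remaining elements guarantee this.
    have hne : ∀ x ∉ X, ∀ y ∉ X, x ≠ y → k ≠ 0 := by
      rintro x hx y hy hxy rfl
      have := Finset.card_eq_zero.mp (hins x hx)
      have : y ∈ (insert x X)ᶜ := by simp [hy, hxy.symm]
      simp_all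
    have hleft : ∑ a ∈ Xᶜ.toLeft, chainCount (IsShuffleSegment u v) k (insert (Sum.inl a) X) =
        if Xᶜ.toLeft.card = 0 then 0 else k.choose (Xᶜ.toLeft.card - 1) := by
      split_ifs with h0
      · rw [Finset.card_eq_zero.mp h0, Finset.sum_empty]
      · obtain ⟨t, ht, htop⟩ := u.exists_top _ (Finset.card_ne_zero.mp h0)
        have htX : Sum.inl t ∉ X := by simpa using ht
        rw [Finset.sum_eq_single t _ fun h => absurd ht h]
        · have : (insert (Sum.inl t) X)ᶜ.toLeft = Xᶜ.toLeft.erase t := by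
            ext a
            simp
          rw [ih _ _ (hins _ htX), this, Finset.card_erase_of_mem ht]
          constructor
          · intro a b hab hb
            simp only [Finset.coe_insert, Set.mem_insert_iff, Sum.inl.injEq,
              Finset.mem_coe] at hb ⊢
            rcases hb with rfl | hb
            · right
              by_contra ha
              exact u.asymm hab (htop a (by simpa using ha) (u.ne_of_prefers hab))
            · exact .inr (hX.1 a b hab hb)
          · intro a b hab hb
            simpa using hX.2 a b hab (by simpa using hb)
        · intro a ha hat
          have haX : Sum.inl a ∉ X := by simpa using ha
          refine chainCount_eq_zero (hne _ haX _ htX (by simpa using hat)) fun h => htX ?_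
          have := h.1 t a (htop a ha hat) (by simp)
          simpa [Ne.symm hat] using this
    have hright : ∑ b ∈ Xᶜ.toRight, chainCount (IsShuffleSegment u v) k (insert (Sum.inr b) X) =
        if Xᶜ.toRight.card = 0 then 0 else k.choose Xᶜ.toLeft.card := by
      split_ifs with h0
      · rw [Finset.card_eq_zero.mp h0, Finset.sum_empty]
      · obtain ⟨t, ht, htop⟩ := v.exists_top _ (Finset.card_ne_zero.mp h0)
        have htX : Sum.inr t ∉ X := by simpa using ht
        rw [Finset.sum_eq_single t _ fun h => absurd ht h]
        · have : (insert (Sum.inr t) X)ᶜ.toLeft = Xᶜ.toLeft := by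
            ext a
            simp
          rw [ih _ _ (hins _ htX), this]
          constructor
          · intro a b hab hb
            simpa using hX.1 a b hab (by simpa using hb)
          · intro a b hab hb
            simp only [Finset.coe_insert, Set.mem_insert_iff, Sum.inr.injEq,
              Finset.mem_coe] at hb ⊢
            rcases hb with rfl | hb
            · right
              by_contra ha
              exact v.asymm hab (htop a (by simpa using ha) (v.ne_of_prefers hab))
            · exact .inr (hX.2 a b hab hb)
        · intro a ha hat
          have haX : Sum.inr a ∉ X := by simpa using ha
          refine chainCount_eq_zero (hne _ haX _ htX (by simpa using hat)) fun h => htX ?_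
          have := h.2 t a (htop a ha hat) (by simp)
          simpa [Ne.symm hat] using this
    have hsplit := Finset.sum_disjSum Xᶜ.toLeft Xᶜ.toRight
      fun x => chainCount (IsShuffleSegment u v) k (insert x X)
    rw [Finset.toLeft_disjSum_toRight, hleft, hright] at hsplit
    rw [chainCount_succ hX, hsplit]
    rcases hl : Xᶜ.toLeft.card with _ | l
    · simp only [if_true, Nat.choose_zero_right]
      rw [if_neg (by omega)]
    · rw [if_neg (Nat.succ_ne_zero l), Nat.choose_succ_succ, Nat.add_sub_cancel]
      by_cases hr : Xᶜ.toRight.card = 0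
      · rw [if_pos hr, Nat.choose_eq_zero_of_lt (show k < l + 1 by omega)]
      · rw [if_neg hr]

theorem ncard_shuffles (u : StrictRanking A) (v : StrictRanking B) :
    (shuffles u v).ncard =
      (Fintype.card A + Fintype.card B).choose (Fintype.card A) := by
  classical
  rw [shuffles_eq, ncard_setOf_forall_adm (u.concat v), chainCount_isShuffleSegment]
  · have : (∅ᶜ : Finset (A ⊕ B)).toLeft = Finset.univ := by ext; simp
    rw [this, Fintype.card_sum, Finset.card_univ]
  · exact ⟨by simp, by simp⟩
  · simp

end Shuffles
-- Walks on a path graph.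
/-- The number of walks of length `k` on the path graph with vertices `0, …, T` that start
at `s`. -/
def walkCount (T : ℕ) : ℕ → ℕ → ℕ
  | 0, s => if s ≤ T then 1 else 0
  | k + 1, s => if s ≤ T then (if s = 0 then 0 else walkCount T k (s - 1)) + walkCount T k (s + 1)
      else 0

/-- The values of `walkCount T k` at `0, …, T`. -/
def walkRow (T : ℕ) : ℕ → List ℕ
  | 0 => List.replicate (T + 1) 1
  | k + 1 => List.zipWith (· + ·) (0 :: walkRow T k) ((walkRow T k).tail ++ [0])

theorem length_walkRow (T k : ℕ) : (walkRow T k).length = T + 1 := by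
  induction k with
  | zero => simp [walkRow]
  | succ k ih => simp [walkRow, ih]

/-- The recursion for `walkCount` branches at each step; computing whole rows keeps the kernel
evaluation small. -/
theorem walkCount_eq_getD (T k s : ℕ) : walkCount T k s = (walkRow T k).getD s 0 := by
  induction k generalizing s with
  | zero =>
    by_cases h : s ≤ T
    · simp [walkCount, walkRow, h, Nat.lt_succ_of_le h]
    · rw [List.getD_eq_default _ _ (by rw [length_walkRow]; omega)]
      simp [walkCount, h]
  | succ k ih =>
    by_cases h : s ≤ T
    · have h' : s < (walkRow T (k + 1)).length := by rw [length_walkRow]; omega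
      rw [List.getD_eq_getElem _ _ h']
      simp only [walkCount, h, if_true, walkRow, List.getElem_zipWith, ih]
      congr 1
      · rcases s with _ | s
        · simp
        · have : s < (walkRow T k).length := by rw [length_walkRow]; omega
          simp [this]
      · have hl := length_walkRow T k
        rcases h.lt_or_eq with h | rfl
        · have : s + 1 < (walkRow T k).length := by omega
          rw [List.getElem_append_left (by simp; omega)]
          simp [this]
        · rw [List.getElem_append_right (by simp; omega), List.getD_eq_default _ _ (by omega)]
          simp
    · rw [List.getD_eq_default _ _ (by rw [length_walkRow]; omega)]
      simp [walkCount, h]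

/-- The number of walks of length `n - 2` on the path graph with vertices `0, …, n + 1` that start
at an even vertex. -/
def evenWalks (n : ℕ) : ℕ :=
  let r := walkRow (n + 1) (n - 2)
  ((List.range ((n + 1) / 2 + 1)).map fun i => r.getD (2 * i) 0).sum

/-! ### Initial segments of Fishburn orders as arcs of a circle. -/

/-- The condition on initial segments that defines Fishburn's domain. -/
def IsFishburnSegment (n : ℕ) (X : Set (Fin n)) : Prop :=
  ∀ i j k : Fin n, i < j → j < k →
    (Even (j.val + 1) → i ∈ X → k ∈ X → j ∈ X) ∧ (Odd (j.val + 1) → j ∈ X → i ∈ X ∨ k ∈ X)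

/-- If an order violates the condition at `i < j < k`, the inadmissible segment is the one above `j`
for an even label, and the one above the higher of `i`, `k` for an odd label. -/
theorem fishburn_eq (n : ℕ) :
    fishburn n = {u | ∀ a, IsFishburnSegment n {x | u.prefers x a}} := by
  ext u
  constructor
  · intro hu a i j k hij hjk
    obtain ⟨h₁, h₂⟩ := hu i j k hij hjk
    simp only [Set.mem_ofPred_eq]
    have key : ∀ x y, u.prefers x a → ¬ u.prefers y a → u.prefers x y := by
      intro x y hx hy
      by_cases h : y = a
      · exact h ▸ hx
      · exact u.trans _ _ _ hx ((u.total y a h).resolve_left hy)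
    refine ⟨fun hj hi hk => ?_, fun hj hja => ?_⟩
    · by_contra hja
      exact h₁ hj ⟨key _ _ hi hja, key _ _ hk hja⟩
    · by_contra! h
      exact h₂ hj ⟨key _ _ hja h.1, key _ _ hja h.2⟩
  · intro hu i j k hij hjk
    refine ⟨fun hj h => u.irrefl j ((hu j i j k hij hjk).1 hj h.1 h.2), fun hj h => ?_⟩
    rcases u.total i k (hij.trans hjk).ne with hik | hik
    · exact ((hu i i j k hij hjk).2 hj h.1).elim (u.irrefl i) (u.asymm hik)
    · exact ((hu k i j k hij hjk).2 hj h.2).elim (u.asymm hik) (u.irrefl k)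

/-- Membership of the alternative `v` in the arc from `lo` to `hi` of the circle on which the
alternatives are arranged in the order `…, 5, 3, 1, 2, 4, 6, …`, with `1` in position `0`. -/
def InArc (n lo hi v : ℤ) : Prop :=
  (v % 2 = 0 ∧ 2 * lo ≤ v ∧ v ≤ 2 * hi) ∨ (v % 2 = 1 ∧ (v ≤ 1 - 2 * lo ∨ 2 * n - 2 * hi + 1 ≤ v))

/-- The alternative in position `lo - 1`. -/
def arcLeft (lo : ℤ) : ℤ := if 2 ≤ lo then 2 * lo - 2 else 3 - 2 * lo

/-- The alternative in position `hi + 1`. -/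
def arcRight (n hi : ℤ) : ℤ := if 2 * hi + 2 ≤ n then 2 * hi + 2 else 2 * n - 2 * hi - 1

/-- The bounds on `lo` and `hi` for an arc to be a possible initial segment. -/
def ArcBounds (n lo hi : ℤ) : Prop := lo ≤ hi ∧ 0 ≤ lo + hi ∧ lo + hi ≤ n + 1 ∧ hi - lo + 2 ≤ n

section Arc

variable {n lo hi : ℤ}

/-- An even `v` has position `v / 2`; an odd `v` has position `(1 - v) / 2` or, once round the
circle, `(1 - v) / 2 + n`. Statements about arcs thus become linear arithmetic with parities. -/
theorem InArc.even_between (h : ArcBounds n lo hi) {i j k : ℤ} (hi1 : 1 ≤ i) (hij : i < j)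
    (hjk : j < k) (hkn : k ≤ n) (hj : j % 2 = 0) (h1 : InArc n lo hi i) (h2 : InArc n lo hi k) :
    InArc n lo hi j := by
  unfold InArc ArcBounds at *
  omega

theorem InArc.odd_between (h : ArcBounds n lo hi) {i j k : ℤ} (hi1 : 1 ≤ i) (hij : i < j)
    (hjk : j < k) (hkn : k ≤ n) (hj : j % 2 = 1) (h1 : InArc n lo hi j) :
    InArc n lo hi i ∨ InArc n lo hi k := by
  unfold InArc ArcBounds at *
  omega

theorem inArc_left_iff (h : ArcBounds n (lo - 1) hi) {v : ℤ} (hv : 1 ≤ v)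
    (hlo : lo ≤ hi) :
    InArc n (lo - 1) hi v ↔ v = arcLeft lo ∨ InArc n lo hi v := by
  unfold InArc ArcBounds arcLeft at *
  split_ifs <;> omega

theorem inArc_right_iff (h : ArcBounds n lo (hi + 1)) {v : ℤ} (hvn : v ≤ n)
    (hlo : lo ≤ hi) :
    InArc n lo (hi + 1) v ↔ v = arcRight n hi ∨ InArc n lo hi v := by
  unfold InArc ArcBounds arcRight at *
  split_ifs <;> omega

theorem arcLeft_mem (h : ArcBounds n (lo - 1) hi) (hlo : lo ≤ hi) :
    1 ≤ arcLeft lo ∧ arcLeft lo ≤ n ∧ ¬ InArc n lo hi (arcLeft lo) := by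
  unfold InArc ArcBounds arcLeft at *
  split_ifs <;> omega

theorem arcRight_mem (h : ArcBounds n lo (hi + 1)) (hlo : lo ≤ hi) :
    1 ≤ arcRight n hi ∧ arcRight n hi ≤ n ∧ ¬ InArc n lo hi (arcRight n hi) := by
  unfold InArc ArcBounds arcRight at *
  split_ifs <;> omega

/-- The bounds for the extended arc leave at least two alternatives outside the original one, so its
two neighbours differ. -/
theorem arcLeft_ne_arcRight (h : ArcBounds n (lo - 1) hi) (hlo : lo ≤ hi) :
    arcLeft lo ≠ arcRight n hi := by
  unfold ArcBounds arcLeft arcRight at *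
  split_ifs <;> omega

/-- The missing alternative is in position `lo - 1`, equivalently `hi + 1`. If `lo + hi = 0`, it is
the even label `2 * hi + 2 = n`; otherwise `lo ≤ 1` and it is odd. -/
theorem not_inArc_iff_of_eq (h : ArcBounds n lo hi) (hn : hi - lo + 2 = n) {v : ℤ} (hv : 1 ≤ v)
    (hvn : v ≤ n) : ¬ InArc n lo hi v ↔ v = if lo + hi = 0 then n else 3 - 2 * lo := by
  unfold InArc ArcBounds at *
  split_ifs <;> omega

/-- An admissible set that extends an arc by one element is an arc. -/
theorem eq_arcLeft_or_eq_arcRight (h : ArcBounds n lo hi) (hlen : hi - lo + 3 ≤ n) {x : ℤ}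
    (hx1 : 1 ≤ x) (hxn : x ≤ n) (hx : ¬ InArc n lo hi x)
    (heven : ∀ i j k, 1 ≤ i → i < j → j < k → k ≤ n → j % 2 = 0 → i = x ∨ InArc n lo hi i →
      k = x ∨ InArc n lo hi k → j = x ∨ InArc n lo hi j)
    (hodd : ∀ i j k, 1 ≤ i → i < j → j < k → k ≤ n → j % 2 = 1 → j = x ∨ InArc n lo hi j →
      (i = x ∨ InArc n lo hi i) ∨ (k = x ∨ InArc n lo hi k)) :
    (ArcBounds n (lo - 1) hi ∧ x = arcLeft lo) ∨ (ArcBounds n lo (hi + 1) ∧ x = arcRight n hi) := by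
  by_cases hl : ArcBounds n (lo - 1) hi ∧ x = arcLeft lo
  · exact .inl hl
  by_cases hr : ArcBounds n lo (hi + 1) ∧ x = arcRight n hi
  · exact .inr hr
  exfalso
  unfold ArcBounds arcLeft arcRight InArc at *
  -- The test triples combine `x` with end points of the arc or their neighbours: `2 * lo - 2`, `2 *
  -- hi + 2` are even neighbours, `3 - 2 * lo`, `2 * n - 2 * hi - 1` odd ones. `min` and `max` keep
  -- labels within `1, …, n`.
  rcases Int.emod_two_eq_zero_or_one x with hx2 | hx2
  · rcases lt_or_ge x (2 * lo) with hxlo | hxlo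
    · have := heven x (2 * lo - 2) (min (2 * lo) n)
      split_ifs at hl <;> omega
    · have := heven (max 1 (2 * hi)) (2 * hi + 2) x
      split_ifs at hr <;> omega
  · by_cases hx' : x = n ∧ 2 * hi + 2 ≤ n
    · have := heven (max 1 (2 * hi)) (n - 1) x
      clear hodd heven hl hr
      omega
    · have h₁ := heven 1 (2 * lo - 2) (min (2 * lo) n)
      clear heven
      rcases le_or_gt 2 lo with hlo | hlo
      · rcases le_or_gt (2 * hi + 2) n with hhi | hhi
        · have := hodd 1 x n
          clear hodd hl hr
          omega
        · have h₂ := hodd 1 x (2 * n - 2 * hi - 1)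
          have h₃ := hodd 1 x (2 * lo - 2)
          clear hodd hl
          split_ifs at hr
          · omega
          · by_cases hx1 : x = 1
            · clear h₂ h₃; omega
            · clear h₁; omega
      · clear h₁
        rcases le_or_gt (2 * hi + 2) n with hhi | hhi
        · have h₂ := hodd (3 - 2 * lo) x n
          have h₃ := hodd (2 * hi + 2) x n
          clear hodd hr
          split_ifs at hl
          · omega
          · by_cases h0 : lo + hi = 0
            · by_cases h1 : x = 3 - 2 * lo
              · clear h₂; omega
              · clear h₃; omega
            · clear h₃; omega
        · have h₂ := hodd (3 - 2 * lo) x (2 * n - 2 * hi - 1)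
          clear hodd
          split_ifs at hr hl <;> omega

end Arc

/-! ### Chains of arcs and the size of Fishburn's domain. -/

/-- The arc from `lo` to `hi` as a set of alternatives. -/
noncomputable def arc (n : ℕ) (lo hi : ℤ) : Finset (Fin n) :=
  open Classical in Finset.univ.filter fun v => InArc n lo hi ((v.val : ℤ) + 1)

theorem mem_arc {n : ℕ} {lo hi : ℤ} {v : Fin n} :
    v ∈ arc n lo hi ↔ InArc n lo hi ((v.val : ℤ) + 1) := by
  simp [arc]

theorem isFishburnSegment_iff {n : ℕ} {X : Finset (Fin n)} (p : ℤ → Prop)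
    (hX : ∀ v : Fin n, v ∈ X ↔ p ((v.val : ℤ) + 1)) :
    IsFishburnSegment n X ↔ ∀ i j k : ℤ, 1 ≤ i → i < j → j < k → k ≤ n →
      (j % 2 = 0 → p i → p k → p j) ∧ (j % 2 = 1 → p j → p i ∨ p k) := by
  simp only [IsFishburnSegment, Finset.mem_coe, hX, Nat.even_iff, Nat.odd_iff]
  constructor
  · intro h i j k hi hij hjk hk
    lift i to ℕ using by omega
    lift j to ℕ using by omega
    lift k to ℕ using by omega
    have := h ⟨i - 1, by omega⟩ ⟨j - 1, by omega⟩ ⟨k - 1, by omega⟩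
      (by rw [Fin.mk_lt_mk]; omega) (by rw [Fin.mk_lt_mk]; omega)
    simp only [show ((i - 1 : ℕ) : ℤ) + 1 = i by omega, show ((j - 1 : ℕ) : ℤ) + 1 = j by omega,
      show ((k - 1 : ℕ) : ℤ) + 1 = k by omega] at this
    exact ⟨fun hj => this.1 (by omega), fun hj => this.2 (by omega)⟩
  · intro h i j k hij hjk
    rw [Fin.lt_def] at hij hjk
    have := h (i + 1) (j + 1) (k + 1) (by omega) (by omega) (by omega) (by omega)
    exact ⟨fun hj => this.1 (by omega), fun hj => this.2 (by omega)⟩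

theorem isFishburnSegment_arc {n : ℕ} {lo hi : ℤ} (h : ArcBounds n lo hi) :
    IsFishburnSegment n (arc n lo hi) := by
  rw [isFishburnSegment_iff (InArc n lo hi) fun _ => mem_arc]
  exact fun i j k h1 hij hjk hk => ⟨fun hj => InArc.even_between h h1 hij hjk hk hj,
    fun hj => InArc.odd_between h h1 hij hjk hk hj⟩

theorem insert_eq_arc_left {n : ℕ} {lo hi : ℤ} (h : ArcBounds n (lo - 1) hi) (hlo : lo ≤ hi)
    {x : Fin n} (hx : (x.val : ℤ) + 1 = arcLeft lo) :
    insert x (arc n lo hi) = arc n (lo - 1) hi := by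
  ext v
  rw [Finset.mem_insert, mem_arc, mem_arc, inArc_left_iff h (by omega) hlo, ← hx,
    Fin.ext_iff]
  exact or_congr_left (by omega)

theorem insert_eq_arc_right {n : ℕ} {lo hi : ℤ} (h : ArcBounds n lo (hi + 1)) (hlo : lo ≤ hi)
    {x : Fin n} (hx : (x.val : ℤ) + 1 = arcRight n hi) :
    insert x (arc n lo hi) = arc n lo (hi + 1) := by
  ext v
  rw [Finset.mem_insert, mem_arc, mem_arc, inArc_right_iff h (by omega) hlo, ← hx,
    Fin.ext_iff]
  exact or_congr_left (by omega)

theorem sum_ite_label_eq {n : ℕ} {s : Finset (Fin n)} {a : ℤ} (h1 : 1 ≤ a) (hn : a ≤ n)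
    (hs : ∀ x : Fin n, (x.val : ℤ) + 1 = a → x ∈ s) (c : ℕ) :
    ∑ x ∈ s, (if (x.val : ℤ) + 1 = a then c else 0) = c := by
  lift a to ℕ using by omega
  have hb : (((⟨a - 1, by omega⟩ : Fin n).val : ℕ) : ℤ) + 1 = a := by
    simp only
    omega
  rw [Finset.sum_eq_single ⟨a - 1, by omega⟩, if_pos hb]
  · intro x _ hx
    rw [if_neg]
    intro h
    apply hx
    rw [Fin.ext_iff]
    simp only
    omega
  · exact fun h => absurd (hs _ hb) h

theorem walkCount_of_lt {T k s : ℕ} (h : T < s) : walkCount T k s = 0 := by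
  cases k <;> simp [walkCount, h]

/-- Growing left or right moves `lo + hi` down or up by one, and the bounds on `lo + hi` are the
ends of the path. There are `k + 1` alternatives to add but only `k` steps, since the last addition
is forced. -/
theorem chainCount_arc {n : ℕ} (k : ℕ) (lo hi : ℤ) (h : ArcBounds n lo hi)
    (hk : hi - lo + 2 + k = n) :
    chainCount (IsFishburnSegment n) (k + 1) (arc n lo hi) =
      walkCount (n + 1) k (lo + hi).toNat := by
  rw [chainCount_succ (isFishburnSegment_arc h)]
  have hT : (lo + hi).toNat ≤ n + 1 := by
    unfold ArcBounds at h
    omega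
  induction k generalizing lo hi with
  | zero =>
    simp only [chainCount, walkCount, hT, if_true]
    refine Eq.trans ?_ (sum_ite_label_eq (s := Finset.univ) (n := n)
      (a := if lo + hi = 0 then (n : ℤ) else 3 - 2 * lo) ?_ ?_ (fun _ _ => Finset.mem_univ _) 1)
    · rw [← Finset.sum_filter]
      congr 1
      ext x
      rw [Finset.mem_compl, mem_arc, not_inArc_iff_of_eq h (by simpa using hk) (by omega)
        (by omega)]
      simp
    · unfold ArcBounds at h
      split_ifs <;> omega
    · unfold ArcBounds at h
      split_ifs <;> omega
  | succ k ih =>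
    have hlo : lo ≤ hi := h.1
    have hval : ∀ lo hi : ℤ, ArcBounds n lo hi → hi - lo + 2 + k = n →
        chainCount (IsFishburnSegment n) (k + 1) (arc n lo hi) =
          walkCount (n + 1) k (lo + hi).toNat := by
      intro lo hi h hk
      rw [chainCount_succ (isFishburnSegment_arc h)]
      exact ih lo hi h hk (by unfold ArcBounds at h; omega)
    -- Only the two neighbours of the arc contribute; the inner conditions discard a neighbour
    -- beyond an end of the path.
    have hpt : ∀ x ∈ (arc n lo hi)ᶜ,
        chainCount (IsFishburnSegment n) (k + 1) (insert x (arc n lo hi)) =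
          (if (x.val : ℤ) + 1 = arcLeft lo then
            (if lo + hi = 0 then 0 else walkCount (n + 1) k (lo + hi - 1).toNat) else 0) +
          (if (x.val : ℤ) + 1 = arcRight n hi then
            (if lo + hi = n + 1 then 0 else walkCount (n + 1) k (lo + hi + 1).toNat) else 0) := by
      intro x hx
      rw [Finset.mem_compl, mem_arc] at hx
      have hL : ArcBounds n (lo - 1) hi ↔ lo + hi ≠ 0 := by unfold ArcBounds at *; omega
      have hR : ArcBounds n lo (hi + 1) ↔ lo + hi ≠ n + 1 := by unfold ArcBounds at *; omega
      by_cases hxl : ArcBounds n (lo - 1) hi ∧ (x.val : ℤ) + 1 = arcLeft lo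
      · rw [insert_eq_arc_left hxl.1 hlo hxl.2, hval _ _ hxl.1 (by omega), if_pos hxl.2,
          if_neg (hL.mp hxl.1), if_neg (hxl.2 ▸ arcLeft_ne_arcRight hxl.1 hlo), add_zero]
        congr 2
        omega
      · by_cases hxr : ArcBounds n lo (hi + 1) ∧ (x.val : ℤ) + 1 = arcRight n hi
        · rw [insert_eq_arc_right hxr.1 hlo hxr.2, hval _ _ hxr.1 (by omega), if_pos hxr.2,
            if_neg (hR.mp hxr.1)]
          rw [hL] at hxl
          have : (if (x.val : ℤ) + 1 = arcLeft lo then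
            (if lo + hi = 0 then 0 else walkCount (n + 1) k (lo + hi - 1).toNat) else 0) = 0 := by
            split_ifs <;> simp_all
          rw [this, zero_add]
          congr 2
          omega
        · rw [chainCount_eq_zero (Nat.succ_ne_zero k)]
          · rw [hL] at hxl
            rw [hR] at hxr
            split_ifs <;> simp_all
          · intro hadm
            rw [isFishburnSegment_iff (fun v => v = (x.val : ℤ) + 1 ∨ InArc n lo hi v)
              fun v => by rw [Finset.mem_insert, mem_arc, Fin.ext_iff]
                          exact or_congr_left (by omega)] at hadm
            rcases eq_arcLeft_or_eq_arcRight h (by omega) (by omega) (by omega) hx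
              (fun i j k h1 hij hjk hk => (hadm i j k h1 hij hjk hk).1)
              (fun i j k h1 hij hjk hk => (hadm i j k h1 hij hjk hk).2) with h | h
            · exact hxl h
            · exact hxr h
    rw [Finset.sum_congr rfl hpt, Finset.sum_add_distrib, walkCount, if_pos hT]
    congr 1
    · by_cases h0 : lo + hi = 0
      · simp [h0]
      · have hb : ArcBounds n (lo - 1) hi := by unfold ArcBounds at *; omega
        obtain ⟨h1, h2, h3⟩ := arcLeft_mem hb hlo
        rw [sum_ite_label_eq h1 h2 fun x hx => by rwa [Finset.mem_compl, mem_arc, hx], if_neg h0,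
          if_neg (by unfold ArcBounds at h; omega)]
        congr 1
        omega
    · by_cases h0 : lo + hi = n + 1
      · rw [walkCount_of_lt (show n + 1 < (lo + hi).toNat + 1 by omega)]
        simp [h0]
      · have hb : ArcBounds n lo (hi + 1) := by unfold ArcBounds at *; omega
        obtain ⟨h1, h2, h3⟩ := arcRight_mem hb hlo
        rw [sum_ite_label_eq h1 h2 fun x hx => by rwa [Finset.mem_compl, mem_arc, hx], if_neg h0]
        congr 1
        unfold ArcBounds at h
        omega

theorem ncard_fishburn (n : ℕ) (hn : 2 ≤ n) : (fishburn n).ncard = evenWalks n := by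
  obtain ⟨m, rfl⟩ := Nat.exists_eq_add_of_le' hn
  have hempty : IsFishburnSegment (m + 2) (∅ : Finset (Fin (m + 2))) :=
    fun i j k _ _ => ⟨fun _ h => absurd h (by simp), fun _ h => absurd h (by simp)⟩
  have hsum : evenWalks (m + 2) =
      ∑ i ∈ Finset.range ((m + 3) / 2 + 1), walkCount (m + 3) m (2 * i) := by
    simp only [evenWalks, Nat.add_sub_cancel, walkCount_eq_getD]
    rfl
  rw [fishburn_eq, ncard_setOf_forall_adm (StrictRanking.ofLT _), Fintype.card_fin,
    chainCount_succ hempty, hsum, Finset.compl_empty]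
  symm
  -- The admissible singletons have label `1`, an even label or label `n = m + 2`. The index `i` is
  -- the position on the circle, so odd `n` occurs at `i = (n + 1) / 2`.
  have hmem : ∀ i < (m + 3) / 2 + 1,
      (if i = 0 then 0 else if 2 * i ≤ m + 2 then 2 * i - 1 else m + 1) < m + 2 := by
    intro i hi
    split_ifs <;> omega
  let e : ℕ → Fin (m + 2) := fun i =>
    if hi : i < (m + 3) / 2 + 1 then ⟨_, hmem i hi⟩ else 0
  have he : ∀ i < (m + 3) / 2 + 1,
      (e i).val = if i = 0 then 0 else if 2 * i ≤ m + 2 then 2 * i - 1 else m + 1 := by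
    intro i hi
    simp only [e, dif_pos hi]
  refine Finset.sum_of_injOn e ?_ (fun _ _ => Finset.mem_coe.mpr (Finset.mem_univ _)) ?_ ?_
  · intro i hi j hj hij
    rw [Finset.coe_range, Set.mem_Iio] at hi hj
    have := congrArg Fin.val hij
    rw [he i hi, he j hj] at this
    split_ifs at this <;> omega
  · intro x _ hx
    refine chainCount_eq_zero (Nat.succ_ne_zero m) fun hadm => hx ?_
    rw [isFishburnSegment_iff (fun v => v = (x.val : ℤ) + 1)
      fun v => by rw [insert_empty_eq, Finset.mem_singleton, Fin.ext_iff]; omega] at hadm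
    -- An odd label strictly between `1` and `n` alone is inadmissible: neither end is present.
    have := hadm 1 (x.val + 1) ((m + 2 : ℕ) : ℤ)
    refine ⟨if x.val = 0 then 0 else if x.val % 2 = 1 then (x.val + 1) / 2 else (m + 3) / 2,
      ?_, ?_⟩
    · rw [Finset.coe_range, Set.mem_Iio]
      split_ifs <;> omega
    · rw [Fin.ext_iff, he]
      · split_ifs <;> omega
      · split_ifs <;> omega
  · intro i hi
    rw [Finset.mem_range] at hi
    have : insert (e i) ∅ = arc (m + 2) i i := by
      ext v
      rw [insert_empty_eq, Finset.mem_singleton, mem_arc, Fin.ext_iff, he i hi, InArc]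
      split_ifs <;> omega
    rw [this, chainCount_arc]
    · congr 1
      omega
    · unfold ArcBounds
      omega
    · push_cast
      ring

/-! ### The numerical comparison. -/

theorem ncard_compose_fishburn {n : ℕ} (hn : 2 ≤ n) {u v : StrictRanking (Fin n)}
    (hu : u ∈ fishburn n) (hv : v ∈ fishburn n) :
    (compose (fishburn n) (fishburn n) u v).ncard + 1 =
      evenWalks n * evenWalks n + (2 * n).factorial / (n.factorial * n.factorial) := by
  rw [ncard_compose hu hv, ncard_shuffles, ncard_fishburn n hn, Fintype.card_fin,
    Nat.add_choose, two_mul]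

theorem evenWalks_forty : evenWalks 40 = 4549082342996 := by
  decide +kernel

theorem evenWalks_twenty :
    evenWalks 20 * evenWalks 20 + (2 * 20).factorial / (Nat.factorial 20 * Nat.factorial 20) =
      4611858343415 + 1 := by
  decide +kernel

theorem evenWalks_mul_self_add_le : ∀ n < 20, 2 < n →
    evenWalks n * evenWalks n + (2 * n).factorial / (n.factorial * n.factorial) ≤
      evenWalks (2 * n) := by
  decide +kernel

theorem IsPeakPit.ncard_le_maxPeakPit {A : Type*} {n : ℕ} (e : Fin n ≃ A)
    {D : Set (StrictRanking A)} (hD : IsPeakPit D) : D.ncard ≤ maxPeakPit n :=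
  (maxPeakPit_isGreatest n).2 ⟨_, hD.image_restrict e.toEmbedding,
    Set.ncard_image_of_injective D (restrict_equiv_injective e)⟩

theorem mainTheorem3 :
    -- the composition of two copies of `F_n` has maximal width for a suitable choice of `u`, `v`
    (∀ n : ℕ, ∃ u ∈ fishburn n, ∃ v ∈ fishburn n,
      HasMaximalWidth (compose (fishburn n) (fishburn n) u v)) ∧
    -- for `2 < n ≤ 19` it is smaller than `F_{2n}`
    (∀ n : ℕ, 2 < n → n ≤ 19 → ∀ u ∈ fishburn n, ∀ v ∈ fishburn n,
      HasMaximalWidth (compose (fishburn n) (fishburn n) u v) →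
      (compose (fishburn n) (fishburn n) u v).ncard < (fishburn (2 * n)).ncard) ∧
    -- for `n = 20` it is a larger peak-pit Condorcet domain than `F_40`
    (∀ u ∈ fishburn 20, ∀ v ∈ fishburn 20,
      HasMaximalWidth (compose (fishburn 20) (fishburn 20) u v) →
      IsCondorcetDomain (compose (fishburn 20) (fishburn 20) u v) ∧
      IsPeakPit (compose (fishburn 20) (fishburn 20) u v) ∧
      (compose (fishburn 20) (fishburn 20) u v).ncard = 4611858343415 ∧
      (fishburn 40).ncard < (compose (fishburn 20) (fishburn 20) u v).ncard) ∧
    (fishburn 40).ncard = 4549082342996 ∧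
    (fishburn 40).ncard < maxPeakPit 40 := by
  have hwidth : ∀ n : ℕ, HasMaximalWidth (compose (fishburn n) (fishburn n)
      (StrictRanking.ofLT n) (StrictRanking.ofLT n)) := fun n =>
    hasMaximalWidth_compose (flip_ofLT_mem_fishburn n) (flip_ofLT_mem_fishburn n)
  have hpp : ∀ u ∈ fishburn 20, ∀ v ∈ fishburn 20,
      IsPeakPit (compose (fishburn 20) (fishburn 20) u v) := fun u hu v hv =>
    isPeakPit_compose (fishburn_isPeakPit 20) (fishburn_isPeakPit 20) hu hv
  have hcard : ∀ u ∈ fishburn 20, ∀ v ∈ fishburn 20,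
      (compose (fishburn 20) (fishburn 20) u v).ncard = 4611858343415 := fun u hu v hv =>
    Nat.succ_injective ((ncard_compose_fishburn (by norm_num) hu hv).trans evenWalks_twenty)
  have hforty : (fishburn 40).ncard = 4549082342996 :=
    (ncard_fishburn 40 (by norm_num)).trans evenWalks_forty
  refine ⟨fun n => ⟨_, ofLT_mem_fishburn n, _, ofLT_mem_fishburn n, hwidth n⟩,
    fun n hn hn' u hu v hv _ => ?_, fun u hu v hv _ => ⟨?_, hpp u hu v hv, hcard u hu v hv, ?_⟩,
    hforty, ?_⟩
  -- The `+ 1` for the doubly counted order `uv` turns the computed `≤` into the strict inequality.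
  · rw [← Nat.succ_le_iff, Nat.succ_eq_add_one, ncard_compose_fishburn hn.le hu hv,
      ncard_fishburn (2 * n) (by omega)]
    exact evenWalks_mul_self_add_le n (by omega) hn
  · exact (hpp u hu v hv).isCondorcetDomain ⟨_, .inl ⟨u, hu, v, hv, rfl⟩⟩
  · rw [hforty, hcard u hu v hv]
    norm_num
  · have hmem := ofLT_mem_fishburn 20
    have hle := (hpp _ hmem _ hmem).ncard_le_maxPeakPit (n := 40)
      (finSumFinEquiv (m := 20) (n := 20)).symm
    rw [hcard _ hmem _ hmem] at hle
    rw [hforty]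
    omega
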